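/- Let $k$ be an algebraically closed field and let $X$ be a smooth projective variety over $k$ (an integral closed subscheme of some $\mathbb P^n_k$ that is smooth over $k$). A curve on $X$ is an integral closed subscheme of dimension one. For a Cartier divisor $D$ and a curve $C$ let $D\cdot C=\deg(\mathcal O_X(D)|_C)$ be the intersection number. Let $N_1(X)$ be the group of $1$-cycles (integral combinations of curves) modulo numerical equivalence, and let $N^1(X)_{\mathbb R}$ be the real vector space of divisors with real coefficients modulo numerical equivalence; its rational points are the classes of divisors with rational coefficients. Put $$\mathscr A_X=\{D\in N^1(X)_{\mathbb R} : D\cdot C\ge 1 \text{ for every curve } C\subseteq X\},\qquad \mathrm{Nef}(X)=\{D\in N^1(X)_{\mathbb R} : D\cdot C\ge 0 \text{ for every curve } C\subseteq X\}.$$ Suppose that the monoid of classes of curves, i.e. the submonoid of $N_1(X)$ generated by the classes of the curves on $X$, is finitely generated. Then $\mathscr A_X$ is a polyhedron (an intersection of finitely many closed half-spaces of $N^1(X)_{\mathbb R}$), and there is a rational polytope $A_X\subseteq N^1(X)_{\mathbb R}$ (the convex hull of a nonempty finite set of rational points) such that $$\mathscr A_X=A_X+\mathrm{Nef}(X)$$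 as a Minkowski sum. Moreover, $\mathrm{Nef}(X)$ is the recession cone of $\mathscr A_X$, that is, $\mathrm{Nef}(X)=\{v : x+tv\in\mathscr A_X \text{ for all } x\in\mathscr A_X \text{ and all real } t\ge 0\}$. -/

import Mathlib

open CategoryTheory AlgebraicGeometry
open scoped Pointwise

universe u

noncomputable section

namespace AmpleBody

section ProjectiveSpace

attribute [local instance] MvPolynomial.gradedAlgebra

/-- Projective space `ℙⁿ_k = Proj k[x₀, …, xₙ]`. -/
def projSpace (k : Type u) [Field k] (n : ℕ) : Scheme.{u} :=
  Proj (MvPolynomial.homogeneousSubmodule (Fin (n + 1)) k)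

/-- The structure morphism `ℙⁿ_k ⟶ Spec k`. -/
def projSpaceToSpec (k : Type u) [Field k] (n : ℕ) : projSpace k n ⟶ Spec (.of k) :=
  Proj.toSpecZero (MvPolynomial.homogeneousSubmodule (Fin (n + 1)) k) ≫
    Spec.map (CommRingCat.ofHom
      (algebraMap k (MvPolynomial.homogeneousSubmodule (Fin (n + 1)) k 0)))

end ProjectiveSpace

/-- A smooth projective variety over a field `k` (used below for algebraically closed `k`): an
integral scheme, smooth over `k`, which is a closed subscheme of some `ℙⁿ_k` over `k`. -/
structure SmoothProjectiveVariety (k : Type u) [Field k] where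
  /-- the underlying scheme -/
  scheme : Scheme.{u}
  /-- the structure morphism -/
  str : scheme ⟶ Spec (.of k)
  isIntegral : IsIntegral scheme
  smooth : Smooth str
  projective : ∃ (n : ℕ) (i : scheme ⟶ projSpace k n),
    IsClosedImmersion i ∧ i ≫ projSpaceToSpec k n = str

section Divisors

variable (X : Scheme.{u}) [IsIntegral X]

/-- The image of `𝒪_{X,x}ˣ` in `K(X)ˣ`. -/
def stalkUnits (x : X) : Subgroup (X.functionField)ˣ :=
  (Units.map (algebraMap (X.presheaf.stalk x) X.functionField).toMonoidHom).range

/-- A Cartier divisor on an integral scheme `X`, i.e. a global section of the sheaf `K(X)ˣ / 𝒪_Xˣ`: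
a family of germs in `K(X)ˣ / 𝒪_{X,x}ˣ` that is locally given by one rational function. -/
@[ext]
structure CartierDivisor where
  /-- the germ of the divisor at a point -/
  germ : ∀ x : X, (X.functionField)ˣ ⧸ stalkUnits X x
  locally_principal : ∀ x : X, ∃ U : X.Opens, x ∈ U ∧ ∃ f : (X.functionField)ˣ,
    ∀ y ∈ U, germ y = QuotientGroup.mk f

variable {X}

/-- A local equation of the Cartier divisor at the point `x`
(well defined up to `𝒪_{X,x}ˣ`). -/
def CartierDivisor.localEq (D : CartierDivisor X) (x : X) : (X.functionField)ˣ :=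
  (D.germ x).out

variable (X) in
/-- A curve on `X`: an integral closed subscheme of dimension one. -/
structure Curve where
  /-- the curve as a scheme -/
  scheme : Scheme.{u}
  /-- the inclusion of the curve -/
  ι : scheme ⟶ X
  isIntegral : IsIntegral scheme
  isClosedImmersion : IsClosedImmersion ι
  dim_eq_one : topologicalKrullDim scheme = 1

instance (C : Curve X) : IsIntegral C.scheme := C.isIntegral

instance (C : Curve X) : IsClosedImmersion C.ι := C.isClosedImmersion

instance [IsLocallyNoetherian X] (C : Curve X) : IsLocallyNoetherian C.scheme :=
  LocallyOfFiniteType.isLocallyNoetherian C.ι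

open Classical in
/-- The restriction to `C` of a rational function on `X` that is regular at the generic point of
`C` (that is, which lies in `𝒪_{X,η}`, `η` the generic point of `C`), as a rational function on
`C`. The value for the other rational functions is irrelevant. -/
def Curve.restrict (C : Curve X) (g : X.functionField) : C.scheme.functionField :=
  if h : ∃ a : X.presheaf.stalk (C.ι (genericPoint C.scheme)),
      algebraMap _ X.functionField a = g
  then (C.ι.stalkMap (genericPoint C.scheme)).hom h.choose
  else 0

/-- The intersection number `D · C = deg (𝒪_X(D)|_C)`, over an algebraically closed field.
With `f` a local equation of `D` at the generic point of `C`, the linearly equivalent divisor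
`D' = D - div f` does not contain `C` in its support, so its local equations restrict to nonzero
rational functions on `C`; the degree of `D'|_C` is the sum over the closed points `x` of `C` of
the order of vanishing at `x` (in the sense of lengths over `𝒪_{C,x}`) of a local equation of
`D'` restricted to `C`. All but finitely many terms vanish; the terms at points of `C` that are not
of codimension one vanish by convention. -/
def Curve.intersectionNumber [IsLocallyNoetherian X] (D : CartierDivisor X) (C : Curve X) : ℤ :=
  ∑ᶠ x : C.scheme, Scheme.ord
    (C.restrict (D.localEq (C.ι x) / D.localEq (C.ι (genericPoint C.scheme)) :
      (X.functionField)ˣ)) x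

end Divisors

section Classes

variable {k : Type u} [Field k] (X : SmoothProjectiveVariety k)

instance : IsIntegral X.scheme := X.isIntegral

instance : IsLocallyNoetherian X.scheme :=
  haveI := X.smooth
  LocallyOfFiniteType.isLocallyNoetherian X.str

/-- `D · γ` for a Cartier divisor `D` and a 1-cycle `γ = ∑ n_C C` with integral coefficients. -/
def cyclePairing (D : CartierDivisor X.scheme) : (Curve X.scheme →₀ ℤ) →+ ℤ :=
  (Finsupp.linearCombination ℤ fun C ↦ C.intersectionNumber D).toAddMonoidHom

/-- The 1-cycles numerically equivalent to zero. -/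
def numTrivialCycles : AddSubgroup (Curve X.scheme →₀ ℤ) := ⨅ D, (cyclePairing X D).ker

/-- `N_1(X)`: 1-cycles modulo numerical equivalence. -/
abbrev NLower : Type _ := (Curve X.scheme →₀ ℤ) ⧸ numTrivialCycles X

/-- The class of a curve in `N_1(X)`. -/
def curveClass (C : Curve X.scheme) : NLower X :=
  QuotientAddGroup.mk (Finsupp.single C 1)

/-- The monoid of classes of curves: the submonoid of `N_1(X)` generated by the classes of curves,
i.e. the monoid of classes of effective 1-cycles. -/
def curveMonoid : AddSubmonoid (NLower X) := AddSubmonoid.closure (Set.range (curveClass X))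

/-- `D · C` for a divisor `D = ∑ a_i D_i` with real coefficients. -/
def realPairing (C : Curve X.scheme) : (CartierDivisor X.scheme →₀ ℝ) →ₗ[ℝ] ℝ :=
  Finsupp.linearCombination ℝ fun D ↦ (C.intersectionNumber D : ℝ)

/-- The real divisors numerically equivalent to zero. -/
def numTrivialDivisors : Submodule ℝ (CartierDivisor X.scheme →₀ ℝ) :=
  ⨅ C, LinearMap.ker (realPairing X C)

/-- `N¹(X)_ℝ`: formal real combinations of Cartier divisors modulo numerical equivalence. (The
intersection number being additive in `D`, numerical equivalence identifies in particular the
formal sum of two Cartier divisors with their sum as divisors.) -/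
abbrev NUpperReal : Type _ := (CartierDivisor X.scheme →₀ ℝ) ⧸ numTrivialDivisors X

/-- The linear form `D ↦ D · C` on `N¹(X)_ℝ`. -/
def degreeOn (C : Curve X.scheme) : NUpperReal X →ₗ[ℝ] ℝ :=
  (numTrivialDivisors X).liftQ (realPairing X C) (iInf_le _ C)

/-- The rational points `N¹(X)_ℚ` of `N¹(X)_ℝ`: the classes of divisors with rational
coefficients. -/
def rationalClasses : Set (NUpperReal X) :=
  {v | ∃ D : CartierDivisor X.scheme →₀ ℚ,
    v = Submodule.Quotient.mk (D.mapRange ((↑) : ℚ → ℝ) Rat.cast_zero)}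

/-- The ample body `𝒜_X`. -/
def ampleBody : Set (NUpperReal X) := {D | ∀ C : Curve X.scheme, 1 ≤ degreeOn X C D}

/-- The nef cone. -/
def nefCone : Set (NUpperReal X) := {D | ∀ C : Curve X.scheme, 0 ≤ degreeOn X C D}

/-- A rational polytope in `N¹(X)_ℝ`: the convex hull of a nonempty finite set of rational
points. -/
def IsRationalPolytope (A : Set (NUpperReal X)) : Prop :=
  ∃ F : Finset (NUpperReal X), F.Nonempty ∧ (F : Set (NUpperReal X)) ⊆ rationalClasses X ∧
    A = convexHull ℝ (F : Set (NUpperReal X))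

end Classes

section Convex

variable {V : Type*} [AddCommGroup V] [Module ℝ V]

/-- A polyhedron: an intersection of finitely many closed half-spaces. -/
def IsPolyhedron (P : Set V) : Prop :=
  ∃ H : Finset (Module.Dual ℝ V × ℝ), P = {x | ∀ h ∈ H, h.2 ≤ h.1 x}

/-- The recession cone of a set. -/
def recessionCone (P : Set V) : Set V := {v | ∀ x ∈ P, ∀ t : ℝ, 0 ≤ t → x + t • v ∈ P}

end Convex

end AmpleBody

end

/-! Finite generation yields a finite set `T` of curves whose classes generate all curve classes
(`exists_finset_generating`). Testing against `T` is enough for nefness, and also for the ample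
body, because a nonzero sum of classes of degree at least 1 has degree at least 1 and no curve has
class zero (`curveClass_ne_zero`). So the ample body is `{φ ≥ 1}` and the nef cone `{φ ≥ 0}` for
finitely many forms `φ` with no common kernel. Such a polyhedron is the hull of its vertices plus
its recession cone (`upperBody_eq_add`).

Vertices are rational: applying a `ℚ`-linear retraction of `ℝ` onto `ℚ` to the coefficients
preserves the equations `D · C = 1`, since intersection numbers are integers, and a vertex is the
only solution of its tight equations.

The geometric input is that finitely many curves have positive degree against a common divisor. A
hyperplane containing none of them still meets each one, and the orders of vanishing at the meeting
points are positive (`Curve.intersectionNumber_lt`). This gives both nonzero curve classes and a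
nonempty body. -/

noncomputable section

namespace AmpleBody

/-! ### Polyhedra: vertices, recession cones, rationality. -/

section Polyhedra

variable {V ι : Type*} [AddCommGroup V] [Module ℝ V]

/-- The polyhedron of the points at which all the given linear forms are at least `1`. -/
def upperBody (φ : ι → Module.Dual ℝ V) : Set V := {x | ∀ i, 1 ≤ φ i x}

/-- The dual cone of a family of linear forms. -/
def dualCone (φ : ι → Module.Dual ℝ V) : Set V := {x | ∀ i, 0 ≤ φ i x}

/-- The vertices of `upperBody φ`: the points that are determined by their tight constraints. -/
def upperBodyVertices (φ : ι → Module.Dual ℝ V) : Set V :=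
  {x | x ∈ upperBody φ ∧ ∀ y, (∀ i, φ i x = 1 → φ i y = 1) → y = x}

lemma finite_upperBodyVertices [Finite ι] (φ : ι → Module.Dual ℝ V) :
    (upperBodyVertices φ).Finite := by
  refine Set.Finite.of_finite_image (f := fun x ↦ {i | φ i x = 1}) (Set.toFinite _) ?_
  intro x hx y hy hxy
  refine (hx.2 y fun i hi ↦ ?_).symm
  have : i ∈ {i | φ i x = 1} := hi
  exact (Set.ext_iff.mp hxy i).mp this

/-- Moving from a point of `upperBody φ` in a direction in which some form decreases and along which
the tight constraints stay tight, one reaches a point with more tight constraints. -/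
lemma exists_tight_of_neg [Finite ι] (φ : ι → Module.Dual ℝ V) {x v : V} (hx : x ∈ upperBody φ)
    (hv : ∀ i, φ i x = 1 → φ i v = 0) (hneg : ∃ i, φ i v < 0) :
    ∃ t : ℝ, 0 < t ∧ x + t • v ∈ upperBody φ ∧
      {i | φ i (x + t • v) ≠ 1} ⊂ {i | φ i x ≠ 1} := by
  -- `i₀` is the first constraint to become tight along the ray from `x` in direction `v`.
  obtain ⟨i₀, hi₀, hmin⟩ := Set.exists_min_image {i | φ i v < 0}
    (fun i ↦ (φ i x - 1) / (-φ i v)) (Set.toFinite _) hneg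
  have hi₀' : φ i₀ v < 0 := hi₀
  have hne : φ i₀ x ≠ 1 := fun h ↦ by rw [hv _ h] at hi₀'; exact lt_irrefl _ hi₀'
  have hgt : 1 < φ i₀ x := lt_of_le_of_ne (hx i₀) hne.symm
  refine ⟨(φ i₀ x - 1) / (-φ i₀ v), div_pos (by linarith) (by linarith), fun i ↦ ?_, ?_⟩
  · rw [map_add, map_smul, smul_eq_mul]
    by_cases hi : φ i v < 0
    · have h := hmin i hi
      rw [le_div_iff₀ (by linarith)] at h
      linarith
    · have := hx i
      have h0 : 0 ≤ (φ i₀ x - 1) / (-φ i₀ v) := div_nonneg (by linarith) (by linarith)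
      have := mul_nonneg h0 (not_lt.mp hi)
      linarith
  · refine ⟨fun i hi h ↦ hi ?_, fun h ↦ h hne ?_⟩
    · simp [h, hv i h]
    · rw [map_add, map_smul, smul_eq_mul]
      have : φ i₀ v ≠ 0 := hi₀'.ne
      field_simp
      ring

/-- Induction on the set of non-tight constraints. A non-vertex can move along some `v ≠ 0` keeping
tight constraints tight. If `v` or `-v` is in the cone, move against it and add the displacement
back; otherwise a new constraint is hit in both directions, and `x` lies between the two points
reached. -/
lemma mem_convexHull_add_dualCone [Finite ι] (φ : ι → Module.Dual ℝ V)
    (hφ : ∀ v, (∀ i, φ i v = 0) → v = 0) {x : V} (hx : x ∈ upperBody φ) :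
    x ∈ convexHull ℝ (upperBodyVertices φ) + dualCone φ := by
  have hcone : Convex ℝ (dualCone φ) := by
    intro a ha b hb s t hs ht _ i
    rw [map_add, map_smul, map_smul]
    exact add_nonneg (mul_nonneg hs (ha i)) (mul_nonneg ht (hb i))
  have hconv := (convex_convexHull ℝ (upperBodyVertices φ)).add hcone
  obtain ⟨s, hs⟩ : ∃ s : Set ι, s = {i | φ i x ≠ 1} := ⟨_, rfl⟩
  induction s using (Finite.wellFounded_of_trans_of_irrefl
      (α := Set ι) (· ⊂ ·)).induction generalizing x with
  | _ s ih =>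
  subst hs
  -- shifting by an element of the cone
  have shift : ∀ v ∈ dualCone φ, v ≠ 0 → (∀ i, φ i x = 1 → φ i v = 0) →
      x ∈ convexHull ℝ (upperBodyVertices φ) + dualCone φ := by
    intro v hv hv0 hxv
    have : ∃ i, φ i (-v) < 0 := by
      by_contra! h
      exact hv0 (hφ v fun i ↦ le_antisymm (by simpa using h i) (hv i))
    obtain ⟨t, ht, hmem, hss⟩ := exists_tight_of_neg φ hx
      (fun i hi ↦ by rw [map_neg, hxv i hi, neg_zero]) this
    obtain ⟨a, ha, b, hb, hab⟩ := Set.mem_add.mp (ih _ hss hmem rfl)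
    refine Set.mem_add.mpr ⟨a, ha, b + t • v, fun i ↦ ?_, ?_⟩
    · rw [map_add, map_smul]
      exact add_nonneg (hb i) (mul_nonneg ht.le (hv i))
    · rw [← add_assoc, hab]; simp
  by_cases hvert : x ∈ upperBodyVertices φ
  · exact Set.mem_add.mpr ⟨x, subset_convexHull _ _ hvert, 0, fun i ↦ by simp, add_zero x⟩
  obtain ⟨y, hy, hyx⟩ : ∃ y, (∀ i, φ i x = 1 → φ i y = 1) ∧ y ≠ x := by
    by_contra! h
    exact hvert ⟨hx, h⟩
  have hv0 : y - x ≠ 0 := sub_ne_zero.mpr hyx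
  have hxv : ∀ i, φ i x = 1 → φ i (y - x) = 0 := fun i hi ↦ by
    rw [map_sub, hy i hi, hi, sub_self]
  generalize y - x = v at hv0 hxv
  have hxv' : ∀ i, φ i x = 1 → φ i (-v) = 0 := fun i hi ↦ by rw [map_neg, hxv i hi, neg_zero]
  by_cases h₁ : v ∈ dualCone φ
  · exact shift v h₁ hv0 hxv
  by_cases h₂ : -v ∈ dualCone φ
  · exact shift (-v) h₂ (neg_ne_zero.mpr hv0) hxv'
  obtain ⟨t, ht, hmem, hss⟩ := exists_tight_of_neg φ hx hxv (by simpa [dualCone] using h₁)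
  obtain ⟨t', ht', hmem', hss'⟩ := exists_tight_of_neg φ hx hxv'
    (by by_contra! h; exact h₂ h)
  -- The weights `t' / (t + t')` and `t / (t + t')` make the displacements `t • v` and `-t' • v`
  -- cancel.
  have key := hconv (ih _ hss hmem rfl) (ih _ hss' hmem' rfl)
    (div_nonneg ht'.le (add_pos ht ht').le) (div_nonneg ht.le (add_pos ht ht').le)
    (by rw [← add_div, add_comm, div_self (add_pos ht ht').ne'])
  convert key using 1
  have : t + t' ≠ 0 := (add_pos ht ht').ne'
  match_scalars <;> field_simp <;> ring

lemma upperBody_eq_add [Finite ι] (φ : ι → Module.Dual ℝ V)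
    (hφ : ∀ v, (∀ i, φ i v = 0) → v = 0) :
    upperBody φ = convexHull ℝ (upperBodyVertices φ) + dualCone φ := by
  refine Set.Subset.antisymm (fun x hx ↦ mem_convexHull_add_dualCone φ hφ hx) ?_
  rintro _ ⟨a, ha, b, hb, rfl⟩ i
  have hconv : Convex ℝ (upperBody φ) := by
    intro p hp q hq s t hs ht hst j
    rw [map_add, map_smul, map_smul, smul_eq_mul, smul_eq_mul]
    nlinarith [mul_le_mul_of_nonneg_left (hp j) hs, mul_le_mul_of_nonneg_left (hq j) ht]
  have := convexHull_min (fun x hx ↦ hx.1) hconv ha i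
  have := hb i
  simp only [map_add]
  linarith

lemma recessionCone_upperBody (φ : ι → Module.Dual ℝ V) (hne : (upperBody φ).Nonempty) :
    recessionCone (upperBody φ) = dualCone φ := by
  refine Set.Subset.antisymm (fun v hv i ↦ ?_) (fun v hv x hx t ht i ↦ ?_)
  · obtain ⟨x, hx⟩ := hne
    by_contra! hneg
    have h1 := hx i
    -- At this time the form has dropped to `0`, below the bound `1`.
    have h := hv x hx (φ i x / (-φ i v)) (div_nonneg (by linarith) (by linarith)) i
    rw [map_add, map_smul, smul_eq_mul, div_mul_eq_mul_div, mul_div_assoc, div_neg,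
      div_self hneg.ne] at h
    linarith
  · rw [map_add, map_smul, smul_eq_mul]
    have := mul_nonneg ht (hv i)
    have := hx i
    linarith

/-- There is a `ℚ`-linear retraction of `ℝ` onto `ℚ`. -/
lemma exists_rational_retraction : ∃ π : ℝ →ₗ[ℚ] ℚ, ∀ q : ℚ, π q = q := by
  obtain ⟨π, hπ⟩ := (Algebra.linearMap ℚ ℝ).exists_leftInverse_of_injective
    (LinearMap.ker_eq_bot.mpr (algebraMap ℚ ℝ).injective)
  exact ⟨π, fun q ↦ LinearMap.congr_fun hπ q⟩

end Polyhedra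

/-! ### Orders of vanishing on one-dimensional and locally Noetherian schemes. -/

section OrderOfVanishing

variable {Y : Scheme.{u}} [IsIntegral Y]

lemma coheight_eq_one (hY : topologicalKrullDim Y = 1) {x : Y} (hx : x ≠ genericPoint Y) :
    Order.coheight x = 1 := by
  refine le_antisymm ?_ ?_
  · let := specializationOrder Y
    have h : StrictMono (irreducibleSetEquivPoints (α := Y)).symm := OrderIso.strictMono _
    have h1 := Order.coheight_le_coheight_apply_of_strictMono _ h x
    have h2 := Order.coheight_le_krullDim ((irreducibleSetEquivPoints (α := Y)).symm x)
    rw [show Order.krullDim (TopologicalSpace.IrreducibleCloseds Y) = 1 from hY] at h2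
    exact h1.trans (by exact_mod_cast h2)
  · rw [Order.one_le_iff_pos, Order.coheight_pos]
    intro hmax
    have h : genericPoint Y ⤳ x := genericPoint_specializes x
    exact hx ((Specializes.antisymm h (hmax (b := genericPoint Y) h)).eq.symm)

lemma specializes_eq_of_coheight_eq_one {x y : Y} (hx : Order.coheight x = 1) (h : y ⤳ x)
    (hy : y ≠ genericPoint Y) : y = x := by
  by_contra hne
  have hxy : x < y := by
    refine lt_of_le_not_ge (show x ≤ y from h) fun h' ↦ hne ?_
    exact (Specializes.antisymm h (show x ⤳ y from h')).eq
  have hyη : y < genericPoint Y := by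
    refine lt_of_le_not_ge (genericPoint_specializes y) fun h' ↦ hy ?_
    exact (Specializes.antisymm h' (genericPoint_specializes y)).eq
  have h1 := Order.coheight_add_one_le hxy
  have h2 := Order.coheight_add_one_le hyη
  rw [hx] at h1
  have h3 : Order.coheight y = 0 := by
    by_contra h0
    have : 1 ≤ Order.coheight y := Order.one_le_iff_ne_zero.mpr h0
    have := (add_le_add_left this 1).trans h1
    exact absurd this (by decide)
  rw [h3] at h2
  simp at h2

variable [IsLocallyNoetherian Y]

lemma ord_algebraMap_of_isUnit {y : Y} {a : Y.presheaf.stalk y} (ha : IsUnit a) :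
    Scheme.ord (algebraMap _ Y.functionField a) y = 0 := by
  by_cases hy : Order.coheight y = 1
  · have : Ring.KrullDimLE 1 (Y.presheaf.stalk y) := krullDimLE_of_coheight_le hy.le
    rw [Scheme.ord_eq_iff hy ((ha.map _).ne_zero)]
    exact Ring.ordFrac_of_isUnit ha
  · simp [hy]

lemma ord_algebraMap_nonneg {y : Y} {a : Y.presheaf.stalk y} (ha : a ≠ 0) :
    0 ≤ Scheme.ord (algebraMap _ Y.functionField a) y := by
  by_cases hy : Order.coheight y = 1
  · have : Ring.KrullDimLE 1 (Y.presheaf.stalk y) := krullDimLE_of_coheight_le hy.le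
    have ha' : algebraMap _ Y.functionField a ≠ 0 := by
      rwa [Ne, FaithfulSMul.algebraMap_eq_zero_iff]
    rw [Scheme.le_ord_iff hy ha']
    exact Ring.ordFrac_ge_one_of_ne_zero ha
  · simp [hy]

/-- Order zero would mean that the quotient of the stalk by `(a)` has length zero, making `a` a
unit. -/
lemma ord_algebraMap_pos {y : Y} (hy : Order.coheight y = 1) {a : Y.presheaf.stalk y}
    (ha : a ≠ 0) (hau : ¬ IsUnit a) :
    0 < Scheme.ord (algebraMap _ Y.functionField a) y := by
  have : Ring.KrullDimLE 1 (Y.presheaf.stalk y) := krullDimLE_of_coheight_le hy.le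
  have ha' : algebraMap _ Y.functionField a ≠ 0 := by
    rwa [Ne, FaithfulSMul.algebraMap_eq_zero_iff]
  refine lt_of_le_of_ne (ord_algebraMap_nonneg ha) fun h ↦ ?_
  have h' := (Scheme.ord_eq_iff hy ha').mp h.symm
  have h'' : Ring.ordFrac (Y.presheaf.stalk y) (algebraMap _ Y.functionField a) = 1 := h'
  have hmem : a ∈ nonZeroDivisors (Y.presheaf.stalk y) := mem_nonZeroDivisors_of_ne_zero ha
  obtain ⟨n, hn⟩ := ENat.ne_top_iff_exists.mp (Ring.ord_ne_top hmem)
  rw [Ring.ordFrac_eq_ord _ ha, Ring.ordMonoidWithZeroHom_eq_coe _ hmem hn.symm] at h''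
  have hn0 : (n : ℤ) = 0 := by
    have := WithZero.coe_inj.mp (h''.trans WithZero.coe_one.symm)
    simpa using this
  have hn0' : n = 0 := by exact_mod_cast hn0
  rw [hn0', Ring.ord] at hn
  have hs := Module.length_eq_zero_iff.mp (by simpa using hn.symm)
  rw [Ideal.Quotient.subsingleton_iff, Ideal.span_singleton_eq_top] at hs
  exact hau hs

/-- `g` is a unit on a nonempty open `U`, whose complement is a finite union of irreducible closed
sets. A codimension-one point outside `U` must be the generic point of the piece containing it. -/
lemma finite_support_ord [CompactSpace Y] {g : Y.functionField} (hg : g ≠ 0) :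
    (Scheme.ord g).support.Finite := by
  have : IsNoetherian Y := {}
  obtain ⟨U, -, f, hU, rfl, hf⟩ := exists_isUnit_germ_eq Y g hg
  obtain ⟨S, hS, hSclosed, hSirr, hSU⟩ :=
    TopologicalSpace.NoetherianSpace.exists_finite_set_isClosed_irreducible
      (s := (U : Set Y)ᶜ) U.isOpen.isClosed_compl
  classical
  refine (hS.image fun t ↦ if ht : IsIrreducible t then ht.genericPoint else genericPoint Y).subset
    fun x hx ↦ ?_
  have hx1 : Order.coheight x = 1 := by
    by_contra h
    exact hx (Scheme.ord_eq_zero_of_coheight_neq_one h _)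
  have hxU : x ∈ (U : Set Y)ᶜ := fun h ↦ hx (Scheme.ord_of_isUnit hf h)
  rw [hSU] at hxU
  obtain ⟨t, ht, hxt⟩ := hxU
  refine ⟨t, ht, ?_⟩
  have hgen := (hSirr t ht).isGenericPoint_genericPoint (hSclosed t ht)
  simp only [hSirr t ht, dif_pos]
  refine specializes_eq_of_coheight_eq_one hx1 (hgen.specializes hxt) fun h ↦ ?_
  have : (hSirr t ht).genericPoint ∈ (U : Set Y)ᶜ := hSU ▸ ⟨t, ht, hgen.mem⟩
  rw [h] at this
  exact this (((genericPoint_spec Y).mem_open_set_iff U.isOpen).mpr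
    (by simpa using Set.nonempty_coe_sort.mp hU))

end OrderOfVanishing

/-! ### Restricting Cartier divisors to a curve. -/

section Restriction

lemma Curve.generic_specializes {X : Scheme.{u}} (C : Curve X) (x : C.scheme) :
    C.ι (genericPoint C.scheme) ⤳ C.ι x :=
  (genericPoint_specializes x).map C.ι.continuous

variable {X : Scheme.{u}} [IsIntegral X] (C : Curve X)

lemma algebraMap_stalkSpecializes {x y : X} (h : x ⤳ y) (a : X.presheaf.stalk y) :
    algebraMap _ X.functionField (X.presheaf.stalkSpecializes h a) =
      algebraMap _ X.functionField a := by
  simp only [RingHom.algebraMap_toAlgebra]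
  exact X.presheaf.stalkSpecializes_comp_apply _ h a

lemma stalkUnits_le {x y : X} (h : x ⤳ y) : stalkUnits X y ≤ stalkUnits X x := by
  rintro _ ⟨a, rfl⟩
  refine ⟨Units.map (X.presheaf.stalkSpecializes h).hom.toMonoidHom a, ?_⟩
  ext
  exact algebraMap_stalkSpecializes h _

lemma Curve.restrict_algebraMap_generic
    (a : X.presheaf.stalk (C.ι (genericPoint C.scheme))) :
    C.restrict (algebraMap _ X.functionField a) = C.ι.stalkMap (genericPoint C.scheme) a := by
  have h : ∃ b : X.presheaf.stalk (C.ι (genericPoint C.scheme)),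
      algebraMap _ X.functionField b = algebraMap _ X.functionField a := ⟨a, rfl⟩
  rw [Curve.restrict, dif_pos h]
  congr 1
  exact FaithfulSMul.algebraMap_injective _ _ h.choose_spec

lemma Curve.restrict_algebraMap (x : C.scheme) (a : X.presheaf.stalk (C.ι x)) :
    C.restrict (algebraMap _ X.functionField a) =
      algebraMap _ C.scheme.functionField (C.ι.stalkMap x a) := by
  rw [← algebraMap_stalkSpecializes (C.generic_specializes x), Curve.restrict_algebraMap_generic]
  exact Scheme.Hom.stalkSpecializes_stalkMap_apply C.ι _ _ (genericPoint_specializes x) a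

lemma Curve.restrict_mul {f g : (X.functionField)ˣ}
    (hf : f ∈ stalkUnits X (C.ι (genericPoint C.scheme)))
    (hg : g ∈ stalkUnits X (C.ι (genericPoint C.scheme))) :
    C.restrict (f * g : (X.functionField)ˣ) = C.restrict f * C.restrict g := by
  obtain ⟨a, rfl⟩ := hf
  obtain ⟨b, rfl⟩ := hg
  have h1 := C.restrict_algebraMap_generic (a : X.presheaf.stalk _)
  have h2 := C.restrict_algebraMap_generic (b : X.presheaf.stalk _)
  have h3 := C.restrict_algebraMap_generic ((a : X.presheaf.stalk _) * (b : X.presheaf.stalk _))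
  rw [map_mul (C.ι.stalkMap (genericPoint C.scheme)).hom, ← h1, ← h2] at h3
  refine Eq.trans (congrArg C.restrict ?_) h3
  exact (map_mul (algebraMap _ X.functionField) _ _).symm

lemma Curve.restrict_ne_zero {f : (X.functionField)ˣ}
    (hf : f ∈ stalkUnits X (C.ι (genericPoint C.scheme))) : C.restrict f ≠ 0 := by
  obtain ⟨a, rfl⟩ := hf
  have h1 := C.restrict_algebraMap_generic (a : X.presheaf.stalk _)
  refine ne_of_eq_of_ne h1 ?_
  exact (a.isUnit.map (C.ι.stalkMap (genericPoint C.scheme)).hom).ne_zero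

lemma CartierDivisor.mk_localEq (D : CartierDivisor X) (x : X) :
    (QuotientGroup.mk (D.localEq x) : (X.functionField)ˣ ⧸ stalkUnits X x) = D.germ x :=
  Quotient.out_eq' _

lemma div_mem_stalkUnits {x : X} {f g : (X.functionField)ˣ}
    (h : (QuotientGroup.mk f : (X.functionField)ˣ ⧸ stalkUnits X x) = QuotientGroup.mk g) :
    f / g ∈ stalkUnits X x := by
  have := QuotientGroup.eq.mp h.symm
  rwa [mul_comm, ← div_eq_mul_inv] at this

/-- A neighbourhood of `y` contains its generization `x`, so both local equations can be compared
with the same `f`. -/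
lemma CartierDivisor.localEq_div_mem (D : CartierDivisor X) {x y : X} (h : x ⤳ y) :
    D.localEq y / D.localEq x ∈ stalkUnits X x := by
  obtain ⟨U, hyU, f, hf⟩ := D.locally_principal y
  have hxU : x ∈ U := h.mem_open U.isOpen hyU
  have h1 := div_mem_stalkUnits ((D.mk_localEq y).trans (hf y hyU))
  have h2 := div_mem_stalkUnits ((D.mk_localEq x).trans (hf x hxU))
  have h3 := (stalkUnits X x).div_mem (stalkUnits_le h h1) h2
  rwa [div_div_div_cancel_right] at h3

variable [IsLocallyNoetherian X]

lemma Curve.ord_restrict_of_mem {x : C.scheme} {f : (X.functionField)ˣ}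
    (hf : f ∈ stalkUnits X (C.ι x)) : Scheme.ord (C.restrict f) x = 0 := by
  obtain ⟨a, rfl⟩ := hf
  have h1 := C.restrict_algebraMap x (a : X.presheaf.stalk _)
  have h2 := ord_algebraMap_of_isUnit (a.isUnit.map (C.ι.stalkMap x).hom)
  rw [← h2]
  exact congrFun (congrArg _ h1) x

lemma Curve.ord_restrict_mul {x : C.scheme} {f g : (X.functionField)ˣ}
    (hf : f ∈ stalkUnits X (C.ι (genericPoint C.scheme)))
    (hg : g ∈ stalkUnits X (C.ι (genericPoint C.scheme))) :
    Scheme.ord (C.restrict (f * g : (X.functionField)ˣ)) x =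
      Scheme.ord (C.restrict f) x + Scheme.ord (C.restrict g) x := by
  rw [C.restrict_mul hf hg, Scheme.ord_mul (C.restrict_ne_zero hf) (C.restrict_ne_zero hg)]

/-- All but finitely many terms of the sum defining the intersection number vanish. -/
lemma Curve.finite_support_ord_localEq [CompactSpace C.scheme] (D : CartierDivisor X) :
    (Function.support fun x : C.scheme ↦ Scheme.ord (C.restrict
      (D.localEq (C.ι x) / D.localEq (C.ι (genericPoint C.scheme)) :
        (X.functionField)ˣ)) x).Finite := by
  set η := genericPoint C.scheme
  -- By compactness finitely many equations `f y` suffice; replacing the local equation at `x` by `f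
  -- y` changes it by a unit there, so each order is that of one of finitely many nonzero functions.
  choose U hU f hf using fun x : C.scheme ↦ D.locally_principal (C.ι x)
  obtain ⟨t, ht⟩ := isCompact_univ.elim_finite_subcover
    (fun x : C.scheme ↦ C.ι ⁻¹' (U x : Set X)) (fun x ↦ (U x).isOpen.preimage C.ι.continuous)
    (fun x _ ↦ Set.mem_iUnion.mpr ⟨x, hU x⟩)
  have hmem : ∀ y, f y / D.localEq (C.ι η) ∈ stalkUnits X (C.ι η) := fun y ↦ by
    refine div_mem_stalkUnits ?_
    rw [D.mk_localEq]
    exact (hf y _ ((C.generic_specializes y).mem_open (U y).isOpen (hU y))).symm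
  refine (t.finite_toSet.biUnion fun y _ ↦ finite_support_ord (C.restrict_ne_zero (hmem y))).subset
    fun x hx ↦ ?_
  obtain ⟨y, hy, hxy⟩ := Set.mem_iUnion₂.mp (ht (Set.mem_univ x))
  refine Set.mem_iUnion₂.mpr ⟨y, hy, fun h ↦ hx ?_⟩
  have h1 : D.localEq (C.ι x) / f y ∈ stalkUnits X (C.ι x) :=
    div_mem_stalkUnits ((D.mk_localEq _).trans (hf y _ hxy))
  have h2 := C.ord_restrict_mul (x := x) (stalkUnits_le (C.generic_specializes x) h1) (hmem y)
  rw [div_mul_div_cancel, C.ord_restrict_of_mem h1, h, add_zero] at h2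
  exact h2

/-- Two Cartier divisors with the same germ at the generic point of `C`, whose difference is
effective along `C` and not zero along `C`, have different intersection numbers with `C`. -/
lemma Curve.intersectionNumber_lt [CompactSpace C.scheme] {D E : CartierDivisor X}
    (hgen : D.germ (C.ι (genericPoint C.scheme)) = E.germ (C.ι (genericPoint C.scheme)))
    (heff : ∀ x : C.scheme, ∃ a : X.presheaf.stalk (C.ι x),
      algebraMap _ X.functionField a =
        (D.localEq (C.ι x) / E.localEq (C.ι x) : (X.functionField)ˣ))
    (hzero : ∃ x : C.scheme, D.germ (C.ι x) ≠ E.germ (C.ι x)) :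
    C.intersectionNumber E < C.intersectionNumber D := by
  have hloc : D.localEq (C.ι (genericPoint C.scheme)) =
      E.localEq (C.ι (genericPoint C.scheme)) := by
    rw [CartierDivisor.localEq, CartierDivisor.localEq, hgen]
  have hmem (x : C.scheme) : D.localEq (C.ι x) / E.localEq (C.ι x) ∈
      stalkUnits X (C.ι (genericPoint C.scheme)) := by
    have h1 := D.localEq_div_mem (C.generic_specializes x)
    have h2 := E.localEq_div_mem (C.generic_specializes x)
    have h3 := Subgroup.div_mem _ h1 h2
    rwa [hloc, div_div_div_cancel_right] at h3
  -- Termwise, the contribution of `D` is that of `E` plus the order of the quotient, which is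
  -- nonnegative by `heff`.
  have hmul (x : C.scheme) := C.ord_restrict_mul (x := x) (hmem x)
    (E.localEq_div_mem (C.generic_specializes x))
  simp only [div_mul_div_cancel] at hmul
  have hne (x : C.scheme) := C.restrict_ne_zero (hmem x)
  have hnonneg (x : C.scheme) : 0 ≤ Scheme.ord
      (C.restrict (D.localEq (C.ι x) / E.localEq (C.ι x) : (X.functionField)ˣ)) x := by
    obtain ⟨a, ha⟩ := heff x
    have := hne x
    rw [← ha, C.restrict_algebraMap] at this ⊢
    exact ord_algebraMap_nonneg fun h ↦ this (by rw [h, map_zero])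
  have hD := C.finite_support_ord_localEq D
  have hE := C.finite_support_ord_localEq E
  rw [hloc] at hD
  unfold Curve.intersectionNumber
  rw [hloc]
  rw [finsum_eq_sum_of_support_subset (s := (hE.union hD).toFinset) _ (by simp),
    finsum_eq_sum_of_support_subset (s := (hE.union hD).toFinset) _ (by simp)]
  have hle (x : C.scheme) := (le_add_of_nonneg_left (hnonneg x)).trans_eq (hmul x).symm
  suffices h : ∃ x : C.scheme, _ by
    obtain ⟨x, hx⟩ := h
    refine Finset.sum_lt_sum (fun y _ ↦ hle y) ⟨x, ?_, hx⟩
    by_contra h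
    simp only [Set.Finite.mem_toFinset, Set.mem_union, Function.mem_support, not_or, not_not] at h
    rw [h.1, h.2] at hx
    exact lt_irrefl _ hx
  · obtain ⟨x, hx⟩ := hzero
    refine ⟨x, ?_⟩
    rw [hmul]
    refine lt_add_of_pos_left _ ?_
    have hxη : x ≠ genericPoint C.scheme := by
      rintro rfl
      exact hx hgen
    obtain ⟨a, ha⟩ := heff x
    have hnx := hne x
    rw [← ha, C.restrict_algebraMap] at hnx ⊢
    refine ord_algebraMap_pos (coheight_eq_one C.dim_eq_one hxη)
      (fun h ↦ hnx (by rw [h, map_zero])) fun hu ↦ hx ?_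
    have hau : IsUnit a := (isUnit_map_iff (C.ι.stalkMap x).hom a).mp hu
    rw [← D.mk_localEq, ← E.mk_localEq, eq_comm, QuotientGroup.eq, mul_comm, ← div_eq_mul_inv]
    exact ⟨hau.unit, Units.ext ha⟩

end Restriction

/-! ### Degree-zero fractions and their germs on `Proj`. -/

section Fractions

variable {σ : Type*} {A : Type u} [CommRing A] [SetLike σ A] [AddSubgroupClass σ A]
  (𝒜 : ℕ → σ) [GradedRing 𝒜] {d : ℕ}

/-- The section `l / m` of the structure sheaf of `Proj` over `D₊(m)`, for homogeneous elements
`l`, `m` of the same degree. -/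
def fracSection (l m : 𝒜 d) : Γ(Proj 𝒜, Proj.basicOpen 𝒜 (m : A)) :=
  Proj.awayToSection 𝒜 (m : A)
    (HomogeneousLocalization.mk ⟨d, l, m, Submonoid.mem_powers (m : A)⟩)

/-- The germ of `l / m` at a point at which `m` does not vanish. -/
def fracGerm (l m : 𝒜 d) (p : Proj 𝒜) (hp : p ∈ Proj.basicOpen 𝒜 (m : A)) :
    (Proj 𝒜).presheaf.stalk p :=
  (Proj 𝒜).presheaf.germ (Proj.basicOpen 𝒜 (m : A)) p hp (fracSection 𝒜 l m)

instance isPrime_asHomogeneousIdeal (p : Proj 𝒜) : p.asHomogeneousIdeal.toIdeal.IsPrime :=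
  p.isPrime

/-- The identification of the stalks of `Proj` with homogeneous localizations. -/
def stalkEquiv (p : Proj 𝒜) :
    (Proj 𝒜).presheaf.stalk p ≃+*
      HomogeneousLocalization.AtPrime 𝒜 p.asHomogeneousIdeal.toIdeal :=
  Proj.stalkIso' 𝒜 p

lemma stalkEquiv_fracGerm (l m : 𝒜 d) (p : Proj 𝒜) (hp : p ∈ Proj.basicOpen 𝒜 (m : A)) :
    stalkEquiv 𝒜 p (fracGerm 𝒜 l m p hp) =
      HomogeneousLocalization.mk
        (⟨d, l, m, hp⟩ : HomogeneousLocalization.NumDenSameDeg 𝒜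
          p.asHomogeneousIdeal.toIdeal.primeCompl) :=
  Proj.stalkIso'_germ 𝒜 _ p hp (fracSection 𝒜 l m)

lemma fracGerm_mul (l m n : 𝒜 d) (p : Proj 𝒜) (hm : p ∈ Proj.basicOpen 𝒜 (m : A))
    (hn : p ∈ Proj.basicOpen 𝒜 (n : A)) :
    fracGerm 𝒜 l m p hm * fracGerm 𝒜 m n p hn = fracGerm 𝒜 l n p hn := by
  apply (stalkEquiv 𝒜 p).injective
  rw [map_mul, stalkEquiv_fracGerm, stalkEquiv_fracGerm, stalkEquiv_fracGerm]
  apply HomogeneousLocalization.val_injective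
  rw [HomogeneousLocalization.val_mul]
  simp only [HomogeneousLocalization.val_mk, Localization.mk_mul]
  rw [Localization.mk_eq_mk_iff, Localization.r_iff_exists]
  refine ⟨1, ?_⟩
  simp
  ring

lemma fracGerm_self (m : 𝒜 d) (p : Proj 𝒜) (hm : p ∈ Proj.basicOpen 𝒜 (m : A)) :
    fracGerm 𝒜 m m p hm = 1 := by
  apply (stalkEquiv 𝒜 p).injective
  rw [stalkEquiv_fracGerm, map_one]
  apply HomogeneousLocalization.val_injective
  rw [HomogeneousLocalization.val_mk, HomogeneousLocalization.val_one]
  exact Localization.mk_self_mk _ _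

lemma isUnit_fracGerm_iff (l m : 𝒜 d) (p : Proj 𝒜) (hm : p ∈ Proj.basicOpen 𝒜 (m : A)) :
    IsUnit (fracGerm 𝒜 l m p hm) ↔ p ∈ Proj.basicOpen 𝒜 (l : A) := by
  refine ⟨fun h ↦ ?_, fun h ↦ IsUnit.of_mul_eq_one (fracGerm 𝒜 m l p h) ?_⟩
  · have h1 := h.map (stalkEquiv 𝒜 p)
    rw [stalkEquiv_fracGerm] at h1
    have h2 := (HomogeneousLocalization.isUnit_iff_isUnit_val _ _ _).mpr h1
    rw [HomogeneousLocalization.val_mk, Localization.mk_eq_mk'] at h2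
    exact (IsLocalization.AtPrime.isUnit_mk'_iff _ p.asHomogeneousIdeal.toIdeal l ⟨m, hm⟩).mp h2
  · rw [fracGerm_mul, fracGerm_self]

lemma stalkSpecializes_fracGerm (l m : 𝒜 d) {p q : Proj 𝒜} (h : p ⤳ q)
    (hp : p ∈ Proj.basicOpen 𝒜 (m : A)) (hq : q ∈ Proj.basicOpen 𝒜 (m : A)) :
    (Proj 𝒜).presheaf.stalkSpecializes h (fracGerm 𝒜 l m q hq) = fracGerm 𝒜 l m p hp :=
  TopCat.Presheaf.germ_stalkSpecializes_apply (Proj 𝒜).presheaf hq h _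

end Fractions

/-! ### Effective Cartier divisors cut out by homogeneous elements. -/

section HypersurfaceSection

variable {σ : Type*} {A : Type u} [CommRing A] [SetLike σ A] [AddSubgroupClass σ A]
  {𝒜 : ℕ → σ} [GradedRing 𝒜] {d : ℕ} {X : Scheme.{u}} [IsIntegral X] (f : X ⟶ Proj 𝒜)

lemma generic_mem_basicOpen {m : A} {x : X} (hx : f x ∈ Proj.basicOpen 𝒜 m) :
    f (genericPoint X) ∈ Proj.basicOpen 𝒜 m :=
  ((genericPoint_specializes x).map f.continuous).mem_open (Proj.basicOpen 𝒜 m).isOpen hx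

/-- The rational function `l / m` on `X`, for a morphism from `X` to `Proj` and homogeneous elements
`l`, `m` of the same degree that do not vanish identically on `X`. -/
def ratUnit (l m : 𝒜 d) (hl : f (genericPoint X) ∈ Proj.basicOpen 𝒜 (l : A))
    (hm : f (genericPoint X) ∈ Proj.basicOpen 𝒜 (m : A)) : (X.functionField)ˣ :=
  Units.mk0 (f.stalkMap (genericPoint X) (fracGerm 𝒜 l m _ hm))
    (((isUnit_fracGerm_iff 𝒜 l m _ hm).mpr hl).map (f.stalkMap (genericPoint X)).hom).ne_zero

variable {l m n : 𝒜 d} (hl : f (genericPoint X) ∈ Proj.basicOpen 𝒜 (l : A))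
  (hm : f (genericPoint X) ∈ Proj.basicOpen 𝒜 (m : A))
  (hn : f (genericPoint X) ∈ Proj.basicOpen 𝒜 (n : A))

lemma ratUnit_mul : ratUnit f l m hl hm * ratUnit f m n hm hn = ratUnit f l n hl hn := by
  ext
  change f.stalkMap _ _ * f.stalkMap _ _ = f.stalkMap _ _
  rw [← map_mul, fracGerm_mul]

lemma algebraMap_stalkMap_fracGerm {x : X} (hx : f x ∈ Proj.basicOpen 𝒜 (m : A)) :
    algebraMap _ X.functionField (f.stalkMap x (fracGerm 𝒜 l m (f x) hx)) =
      ratUnit f l m hl hm := by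
  have h := genericPoint_specializes x
  have h1 := Scheme.Hom.stalkSpecializes_stalkMap_apply f _ _ h (fracGerm 𝒜 l m (f x) hx)
  rw [stalkSpecializes_fracGerm (hp := hm)] at h1
  exact h1.symm

/-- Stalk maps are local homomorphisms, so invertibility can be tested on `Proj`. -/
lemma ratUnit_mem_stalkUnits_iff {x : X} (hx : f x ∈ Proj.basicOpen 𝒜 (m : A)) :
    ratUnit f l m hl hm ∈ stalkUnits X x ↔ f x ∈ Proj.basicOpen 𝒜 (l : A) := by
  rw [← isUnit_fracGerm_iff 𝒜 l m _ hx, ← isUnit_map_iff (f.stalkMap x).hom]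
  constructor
  · rintro ⟨a, ha⟩
    have h1 : algebraMap _ X.functionField (a : X.presheaf.stalk x) = ratUnit f l m hl hm :=
      congrArg Units.val ha
    rw [← algebraMap_stalkMap_fracGerm f hl hm hx] at h1
    rw [← FaithfulSMul.algebraMap_injective _ _ h1]
    exact a.isUnit
  · intro h
    refine ⟨h.unit, Units.ext ?_⟩
    exact algebraMap_stalkMap_fracGerm f hl hm hx

/-- The effective Cartier divisor on `X` cut out by a homogeneous element `l` of degree `d` that
does not vanish identically on `X`, where no point of `X` is a base point of the elements of
degree `d`. -/
def sectionDivisor (hcov : ∀ x : X, ∃ m : 𝒜 d, f x ∈ Proj.basicOpen 𝒜 (m : A)) :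
    CartierDivisor X where
  germ x := QuotientGroup.mk
    (ratUnit f l (hcov x).choose hl (generic_mem_basicOpen f (hcov x).choose_spec))
  locally_principal x := by
    refine ⟨f ⁻¹ᵁ Proj.basicOpen 𝒜 ((hcov x).choose : A), (hcov x).choose_spec,
      ratUnit f l (hcov x).choose hl (generic_mem_basicOpen f (hcov x).choose_spec),
      fun y hy ↦ ?_⟩
    have hx' := generic_mem_basicOpen f (hcov x).choose_spec
    have hy' := generic_mem_basicOpen f (hcov y).choose_spec
    -- The two local equations differ by the quotient of the two denominators, neither of which
    -- vanishes at `f y`.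
    rw [QuotientGroup.eq, ← ratUnit_mul f hl hy' hx', inv_mul_cancel_left,
      ratUnit_mem_stalkUnits_iff f _ _ hy]
    exact (hcov y).choose_spec

lemma sectionDivisor_germ_eq_one_iff
    (hcov : ∀ x : X, ∃ m : 𝒜 d, f x ∈ Proj.basicOpen 𝒜 (m : A)) (x : X) :
    (sectionDivisor f hl hcov).germ x = 1 ↔ f x ∈ Proj.basicOpen 𝒜 (l : A) := by
  rw [← ratUnit_mem_stalkUnits_iff f hl (generic_mem_basicOpen f (hcov x).choose_spec)
    (hcov x).choose_spec]
  exact QuotientGroup.eq_one_iff _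

variable (X) in
/-- The Cartier divisor `0`. -/
def zeroDivisor : CartierDivisor X where
  germ _ := 1
  locally_principal _ := ⟨⊤, trivial, 1, fun _ _ ↦ rfl⟩

lemma sectionDivisor_effective
    (hcov : ∀ x : X, ∃ m : 𝒜 d, f x ∈ Proj.basicOpen 𝒜 (m : A)) (x : X) :
    ∃ a : X.presheaf.stalk x, algebraMap _ X.functionField a =
      ((sectionDivisor f hl hcov).localEq x / (zeroDivisor X).localEq x :
        (X.functionField)ˣ) := by
  have hx := (hcov x).choose_spec
  obtain ⟨u, hu⟩ := div_mem_stalkUnits ((sectionDivisor f hl hcov).mk_localEq x)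
  obtain ⟨v, hv⟩ := (QuotientGroup.eq_one_iff _).mp ((zeroDivisor X).mk_localEq x)
  have h1 := algebraMap_stalkMap_fracGerm f hl (generic_mem_basicOpen f hx) hx
  refine ⟨(u : X.presheaf.stalk x) * f.stalkMap x (fracGerm 𝒜 l _ (f x) hx) *
    (v⁻¹ : (X.presheaf.stalk x)ˣ), ?_⟩
  rw [map_mul, map_mul, h1, ← hv, div_eq_mul_inv, ← map_inv]
  rw [div_eq_iff_eq_mul.mp hu.symm]
  rfl

end HypersurfaceSection

/-! ### Hyperplanes in projective space, and its properness. -/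

section HyperplaneSections

attribute [local instance] MvPolynomial.gradedAlgebra

open MvPolynomial

variable {k : Type u} [Field k] {n : ℕ}

lemma exists_linear_mem_basicOpen (p : projSpace k n) :
    ∃ m : homogeneousSubmodule (Fin (n + 1)) k 1,
      p ∈ Proj.basicOpen (homogeneousSubmodule (Fin (n + 1)) k) (m : MvPolynomial _ k) := by
  have h := Proj.iSup_basicOpen_eq_top' (homogeneousSubmodule (Fin (n + 1)) k)
    (fun i : Fin (n + 1) ↦ (X i : MvPolynomial (Fin (n + 1)) k))
    (fun i ↦ ⟨1, isHomogeneous_X k i⟩) (by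
      refine top_le_iff.mp fun q _ ↦ ?_
      induction q using MvPolynomial.induction_on with
      | C a =>
        exact Subalgebra.algebraMap_mem (Algebra.adjoin (homogeneousSubmodule (Fin (n + 1)) k 0) _)
          ⟨C a, isHomogeneous_C _ a⟩
      | add p q hp hq => exact add_mem (hp trivial) (hq trivial)
      | mul_X p i hp => exact mul_mem (hp trivial) (Algebra.subset_adjoin ⟨i, rfl⟩))
  obtain ⟨i, hi⟩ := TopologicalSpace.Opens.mem_iSup.mp (h.ge (Set.mem_univ p))
  exact ⟨⟨X i, isHomogeneous_X k i⟩, hi⟩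

/-- Over an infinite field, there is a hyperplane avoiding finitely many points of `ℙⁿ`. -/
lemma exists_linear_avoiding [Infinite k] (s : Finset (projSpace k n)) :
    ∃ l : homogeneousSubmodule (Fin (n + 1)) k 1, ∀ p ∈ s,
      p ∈ Proj.basicOpen (homogeneousSubmodule (Fin (n + 1)) k) (l : MvPolynomial _ k) := by
  classical
  -- The linear forms vanishing at `p` form a proper subspace; over an infinite field finitely many
  -- of these do not cover.
  let V (p : projSpace k n) : Submodule k (homogeneousSubmodule (Fin (n + 1)) k 1) :=
    (Submodule.restrictScalars k (HomogeneousIdeal.toIdeal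
      (ProjectiveSpectrum.asHomogeneousIdeal p))).comap (Submodule.subtype _)
  have hV : ⊤ ∉ s.image V := by
    intro h
    obtain ⟨p, -, hp⟩ := Finset.mem_image.mp h
    obtain ⟨m, hm⟩ := exists_linear_mem_basicOpen p
    exact hm (show m ∈ V p from hp ▸ trivial)
  have h := Subspace.biUnion_ne_univ_of_top_notMem hV
  obtain ⟨l, hl⟩ := (Set.ne_univ_iff_exists_notMem _).mp h
  refine ⟨l, fun p hp hlp ↦ hl ?_⟩
  exact Set.mem_iUnion₂.mpr ⟨V p, Finset.mem_image_of_mem V hp, hlp⟩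

variable (k n) in
lemma isProper_projSpaceToSpec : IsProper (projSpaceToSpec k n) := by
  have : IsScalarTower k (homogeneousSubmodule (Fin (n + 1)) k 0)
      (MvPolynomial (Fin (n + 1)) k) := 
    ⟨fun r a p ↦ smul_mul_assoc r (a : MvPolynomial (Fin (n + 1)) k) p⟩
  have : Algebra.FiniteType (homogeneousSubmodule (Fin (n + 1)) k 0)
      (MvPolynomial (Fin (n + 1)) k) :=
    Algebra.FiniteType.of_restrictScalars_finiteType k _ _
  have : IsClosedImmersion (Spec.map (CommRingCat.ofHom
      (algebraMap k (homogeneousSubmodule (Fin (n + 1)) k 0)))) := by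
    refine IsClosedImmersion.spec_of_surjective _ ?_
    rintro ⟨p, hp⟩
    rw [homogeneousSubmodule_zero, Submodule.mem_one] at hp
    obtain ⟨a, rfl⟩ := hp
    exact ⟨a, rfl⟩
  have : IsProper (Proj.toSpecZero (homogeneousSubmodule (Fin (n + 1)) k)) := inferInstance
  exact MorphismProperty.comp_mem @IsProper _ _ this inferInstance

end HyperplaneSections

/-! ### Curves in projective space meet hyperplanes. -/

section Curves

attribute [local instance] MvPolynomial.gradedAlgebra

open MvPolynomial

variable {k : Type u} [Field k] {n : ℕ} {X : Scheme.{u}} (i : X ⟶ projSpace k n)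
  [IsClosedImmersion i] (C : Curve X)

lemma Curve.isProper_toSpec : IsProper ((C.ι ≫ i) ≫ projSpaceToSpec k n) := by
  have := isProper_projSpaceToSpec k n
  infer_instance

include i in
lemma Curve.compactSpace : CompactSpace C.scheme := by
  have := C.isProper_toSpec i
  exact QuasiCompact.compactSpace_of_compactSpace ((C.ι ≫ i) ≫ projSpaceToSpec k n)

/-- A curve meets every hyperplane. -/
lemma Curve.exists_notMem_basicOpen (l : homogeneousSubmodule (Fin (n + 1)) k 1) :
    ∃ x : C.scheme, i (C.ι x) ∉
      Proj.basicOpen (homogeneousSubmodule (Fin (n + 1)) k) (l : MvPolynomial _ k) := by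
  -- Otherwise the curve would be affine and proper over `k`, so its ring of global sections would
  -- be a field and its dimension zero.
  by_contra! h
  let j : C.scheme ⟶ Proj (homogeneousSubmodule (Fin (n + 1)) k) := C.ι ≫ i
  have : IsClosedImmersion j := inferInstanceAs (IsClosedImmersion (C.ι ≫ i))
  have haff := (Proj.isAffineOpen_basicOpen (homogeneousSubmodule (Fin (n + 1)) k)
    (l : MvPolynomial _ k) l.2 zero_lt_one).preimage j
  have htop : j ⁻¹ᵁ Proj.basicOpen (homogeneousSubmodule (Fin (n + 1)) k)
      (l : MvPolynomial _ k) = ⊤ :=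
    top_le_iff.mp fun x _ ↦ h x
  rw [htop] at haff
  have : IsAffine (⊤ : C.scheme.Opens) := haff
  have : IsAffine C.scheme := .of_isIso (Scheme.topIso C.scheme).inv
  have := C.isProper_toSpec i
  let := (isField_of_universallyClosed k ((C.ι ≫ i) ≫ projSpaceToSpec k n)).toField
  have : Subsingleton C.scheme :=
    C.scheme.isoSpec.hom.homeomorph.injective.subsingleton
      (β := PrimeSpectrum Γ(C.scheme, ⊤))
  have h1 := topologicalKrullDim_zero_of_discreteTopology C.scheme
  rw [C.dim_eq_one] at h1
  exact not_le_of_gt zero_lt_one h1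

end Curves

/-! ### A divisor positive on finitely many curves. -/

section Positivity

attribute [local instance] MvPolynomial.gradedAlgebra

variable {k : Type u} [Field k] [Infinite k] (X : SmoothProjectiveVariety k)

/-- Finitely many curves have positive degree with respect to a suitable divisor. -/
lemma exists_intersectionNumber_lt (T : Finset (Curve X.scheme)) :
    ∃ D E : CartierDivisor X.scheme, ∀ C ∈ T,
      C.intersectionNumber E < C.intersectionNumber D := by
  classical
  obtain ⟨n, i, hi, -⟩ := X.projective
  -- Avoiding the generic points of `X` and of the curves ensures that the hyperplane contains none
  -- of them.
  obtain ⟨l, hl⟩ := exists_linear_avoiding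
    (insert (i (genericPoint X.scheme)) (T.image fun C ↦ i (C.ι (genericPoint C.scheme))))
  have hcov (x : X.scheme) := exists_linear_mem_basicOpen (i x)
  have hlX := hl _ (Finset.mem_insert_self _ _)
  refine ⟨sectionDivisor i hlX hcov, zeroDivisor X.scheme, fun C hC ↦ ?_⟩
  have := C.compactSpace i
  refine C.intersectionNumber_lt ?_ (fun x ↦ sectionDivisor_effective i hlX hcov _) ?_
  · exact (sectionDivisor_germ_eq_one_iff i hlX hcov _).mpr
      (hl _ (Finset.mem_insert_of_mem (Finset.mem_image_of_mem _ hC)))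
  · obtain ⟨x, hx⟩ := C.exists_notMem_basicOpen i l
    exact ⟨x, fun h ↦ hx ((sectionDivisor_germ_eq_one_iff i hlX hcov _).mp h)⟩

end Positivity

/-! ### Numerical classes and reduction to finitely many curves. -/

section NumericalClasses

variable {k : Type u} [Field k] (X : SmoothProjectiveVariety k)

/-- The pairing of classes of 1-cycles with a divisor with real coefficients. -/
def classPairing (D : CartierDivisor X.scheme →₀ ℝ) : NLower X →+ ℝ :=
  QuotientAddGroup.lift (numTrivialCycles X)
    (∑ E ∈ D.support, (AddMonoidHom.mulLeft (D E)).comp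
      ((Int.castAddHom ℝ).comp (cyclePairing X E))) fun γ hγ ↦ by
    have h (E : CartierDivisor X.scheme) : cyclePairing X E γ = 0 :=
      (AddSubgroup.mem_iInf.mp hγ) E
    rw [AddMonoidHom.mem_ker, AddMonoidHom.finsetSum_apply]
    exact Finset.sum_eq_zero fun E _ ↦ by simp [h E]

lemma classPairing_curveClass (D : CartierDivisor X.scheme →₀ ℝ) (C : Curve X.scheme) :
    classPairing X D (curveClass X C) = degreeOn X C (Submodule.Quotient.mk D) := by
  change (∑ E ∈ D.support, (AddMonoidHom.mulLeft (D E)).comp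
      ((Int.castAddHom ℝ).comp (cyclePairing X E))) (Finsupp.single C 1) = realPairing X C D
  rw [AddMonoidHom.finsetSum_apply, realPairing, Finsupp.linearCombination_apply, Finsupp.sum]
  exact Finset.sum_congr rfl fun E _ ↦ by simp [cyclePairing]

lemma exists_one_le_degreeOn [Infinite k] (T : Finset (Curve X.scheme)) :
    ∃ v : NUpperReal X, ∀ C ∈ T, 1 ≤ degreeOn X C v := by
  obtain ⟨D, E, h⟩ := exists_intersectionNumber_lt X T
  refine ⟨Submodule.Quotient.mk (Finsupp.single D 1 - Finsupp.single E 1), fun C hC ↦ ?_⟩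
  change 1 ≤ realPairing X C _
  rw [map_sub, realPairing, Finsupp.linearCombination_single, Finsupp.linearCombination_single,
    one_smul, one_smul]
  exact_mod_cast Int.le_sub_left_of_add_le (Int.add_one_le_iff.mpr (h C hC))

lemma curveClass_ne_zero [Infinite k] (C : Curve X.scheme) : curveClass X C ≠ 0 := by
  intro h
  obtain ⟨v, hv⟩ := exists_one_le_degreeOn X {C}
  obtain ⟨D, rfl⟩ := Submodule.Quotient.mk_surjective _ v
  have h1 := hv C (Finset.mem_singleton_self C)
  rw [← classPairing_curveClass, h, map_zero] at h1
  exact not_le_of_gt zero_lt_one h1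

variable {X} in
-- The given generators need not be classes of curves, but each is a sum of finitely many of them.
lemma exists_finset_generating (hX : (curveMonoid X).FG) :
    ∃ T : Finset (Curve X.scheme), ∀ C : Curve X.scheme,
      curveClass X C ∈ AddSubmonoid.closure (curveClass X '' (T : Set (Curve X.scheme))) := by
  classical
  obtain ⟨S, hS⟩ := hX
  have key (s : NLower X) (hs : s ∈ curveMonoid X) : ∃ T : Finset (Curve X.scheme),
      s ∈ AddSubmonoid.closure (curveClass X '' (T : Set (Curve X.scheme))) := by
    induction hs using AddSubmonoid.closure_induction with
    | mem s hs =>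
      obtain ⟨C, rfl⟩ := hs
      exact ⟨{C}, AddSubmonoid.subset_closure ⟨C, by simp, rfl⟩⟩
    | zero => exact ⟨∅, zero_mem _⟩
    | add s t _ _ hs ht =>
      obtain ⟨T, hT⟩ := hs
      obtain ⟨T', hT'⟩ := ht
      refine ⟨T ∪ T', add_mem ?_ ?_⟩
      · exact AddSubmonoid.closure_mono (Set.image_mono (by simp)) hT
      · exact AddSubmonoid.closure_mono (Set.image_mono (by simp)) hT'
  choose! T hT using key
  have hsub (s) (hs : s ∈ S) : s ∈ curveMonoid X := hS ▸ AddSubmonoid.subset_closure hs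
  refine ⟨S.biUnion T, fun C ↦ ?_⟩
  have hC : curveClass X C ∈ AddSubmonoid.closure (S : Set (NLower X)) :=
    hS ▸ AddSubmonoid.subset_closure ⟨C, rfl⟩
  refine AddSubmonoid.closure_le.mpr (fun s hs ↦ ?_) hC
  refine AddSubmonoid.closure_mono (Set.image_mono ?_) (hT s (hsub s hs))
  exact_mod_cast Finset.subset_biUnion_of_mem T hs

/-- For each real divisor there is a rational divisor that has degree `1` on all curves on which the
real divisor has degree `1`. -/
lemma exists_rational_degreeOn_eq (v : NUpperReal X) :
    ∃ w ∈ rationalClasses X, ∀ C : Curve X.scheme, degreeOn X C v = 1 → degreeOn X C w = 1 := by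
  obtain ⟨D, rfl⟩ := Submodule.Quotient.mk_surjective _ v
  obtain ⟨π, hπ⟩ := exists_rational_retraction
  refine ⟨_, ⟨D.mapRange π (map_zero π), rfl⟩, fun C hC ↦ ?_⟩
  change realPairing X C D = 1 at hC
  change realPairing X C _ = 1
  rw [realPairing, Finsupp.linearCombination_apply] at hC ⊢
  have h := congrArg (fun r ↦ (π r : ℝ)) hC
  rw [Finsupp.sum, map_sum] at h
  have h1 : π 1 = 1 := by simpa using hπ 1
  rw [h1, Rat.cast_one] at h
  rw [Finsupp.sum_mapRange_index (by simp), Finsupp.sum_mapRange_index (by simp), Finsupp.sum,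
    ← h, Rat.cast_sum]
  refine Finset.sum_congr rfl fun E _ ↦ ?_
  -- Integrality of the intersection numbers lets `π` pass through the products.
  rw [smul_eq_mul, smul_eq_mul, mul_comm (D E), ← zsmul_eq_mul, map_zsmul, zsmul_eq_mul,
    Rat.cast_mul, Rat.cast_intCast, mul_comm]

variable {X} {T : Finset (Curve X.scheme)} (hT : ∀ C : Curve X.scheme,
  curveClass X C ∈ AddSubmonoid.closure (curveClass X '' (T : Set (Curve X.scheme))))

include hT

lemma degreeOn_mem_of_generating (M : AddSubmonoid ℝ) {v : NUpperReal X}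
    (hv : ∀ C ∈ T, degreeOn X C v ∈ M) (C : Curve X.scheme) : degreeOn X C v ∈ M := by
  obtain ⟨D, rfl⟩ := Submodule.Quotient.mk_surjective _ v
  rw [← classPairing_curveClass]
  refine (AddSubmonoid.closure_le (S := M.comap (classPairing X D))).mpr ?_ (hT C)
  rintro _ ⟨C', hC', rfl⟩
  rw [SetLike.mem_coe, AddSubmonoid.mem_comap, classPairing_curveClass]
  exact hv C' hC'

lemma eq_zero_of_generating {v : NUpperReal X} (hv : ∀ C ∈ T, degreeOn X C v = 0) : v = 0 := by
  have h := degreeOn_mem_of_generating hT ⊥ (v := v) (by simpa using hv)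
  obtain ⟨D, rfl⟩ := Submodule.Quotient.mk_surjective _ v
  rw [Submodule.Quotient.mk_eq_zero, numTrivialDivisors, Submodule.mem_iInf]
  exact fun C ↦ AddSubmonoid.mem_bot.mp (h C)

lemma nefCone_eq_dualCone : nefCone X = dualCone fun C : T ↦ degreeOn X C := by
  refine Set.Subset.antisymm (fun v hv C ↦ hv C) fun v hv ↦ ?_
  exact degreeOn_mem_of_generating hT (AddSubmonoid.nonneg ℝ) fun C hC ↦ hv ⟨C, hC⟩

/-- Numbers at least `1` do not form a submonoid, so the induction carries the alternative `γ = 0`,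
which is excluded for curve classes at the end. -/
lemma ampleBody_eq_upperBody [Infinite k] :
    ampleBody X = upperBody fun C : T ↦ degreeOn X C := by
  refine Set.Subset.antisymm (fun v hv C ↦ hv C) fun v hv C ↦ ?_
  obtain ⟨D, rfl⟩ := Submodule.Quotient.mk_surjective _ v
  have h (γ : NLower X)
      (hγ : γ ∈ AddSubmonoid.closure (curveClass X '' (T : Set (Curve X.scheme)))) :
      γ = 0 ∨ 1 ≤ classPairing X D γ := by
    induction hγ using AddSubmonoid.closure_induction with
    | mem s hs =>
      obtain ⟨C', hC', rfl⟩ := hs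
      rw [classPairing_curveClass]
      exact .inr (hv ⟨C', hC'⟩)
    | zero => exact .inl rfl
    | add s t _ _ hs ht =>
      rcases hs with rfl | hs
      · simpa using ht
      · refine .inr ?_
        rcases ht with rfl | ht
        · simpa using hs
        · rw [map_add]; linarith
  rw [← classPairing_curveClass]
  exact (h _ (hT C)).resolve_left (curveClass_ne_zero X C)

end NumericalClasses

end AmpleBody

end

open AmpleBody in
theorem proposition3p6 {k : Type u} [Field k] [IsAlgClosed k]
    (X : AmpleBody.SmoothProjectiveVariety k) (hX : (AmpleBody.curveMonoid X).FG) :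
    AmpleBody.IsPolyhedron (AmpleBody.ampleBody X) ∧
    (∃ A : Set (AmpleBody.NUpperReal X), AmpleBody.IsRationalPolytope X A ∧
      AmpleBody.ampleBody X = A + AmpleBody.nefCone X) ∧
    AmpleBody.recessionCone (AmpleBody.ampleBody X) = AmpleBody.nefCone X := by
  classical
  have : Infinite k := IsAlgClosed.instInfinite
  obtain ⟨T, hT⟩ := exists_finset_generating hX
  have hdecomp := upperBody_eq_add (fun C : T ↦ degreeOn X C) fun v hv ↦
    eq_zero_of_generating hT fun C hC ↦ hv ⟨C, hC⟩
  have hne : (upperBody fun C : T ↦ degreeOn X C).Nonempty := by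
    obtain ⟨v, hv⟩ := exists_one_le_degreeOn X T
    exact ⟨v, fun C ↦ hv C C.2⟩
  rw [ampleBody_eq_upperBody hT, nefCone_eq_dualCone hT]
  refine ⟨⟨T.image fun C ↦ (degreeOn X C, 1), ?_⟩, ⟨_, ⟨(finite_upperBodyVertices _).toFinset,
    ?_, ?_, by rw [Set.Finite.coe_toFinset]⟩, hdecomp⟩, recessionCone_upperBody _ hne⟩
  · ext v
    simp [upperBody]
  · rw [hdecomp] at hne
    rw [Set.Finite.toFinset_nonempty]
    exact convexHull_nonempty_iff.mp hne.of_add_left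
  · intro v hv
    rw [Set.Finite.coe_toFinset] at hv
    obtain ⟨w, hw, h⟩ := exists_rational_degreeOn_eq X v
    -- The rational class `w` satisfies the tight equations of the vertex `v`, hence equals it.
    rwa [← hv.2 w fun C hC ↦ h C hC]
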